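/- Let $p$ be a prime and $G$ a finite group. For $d\in\mathbb N$ let $\mathcal F(d)$ be the free pro-$p$-$G$ operator group of rank $d$, i.e. the free pro-$p$ group on a basis $x_{i,g}$ ($1\le i\le d$, $g\in G$) with the continuous $G$-action given by $g'x_{i,g}=x_{i,g'g}$. For a pro-$p$ group $P$ define closed subgroups by $P^1=P$, $P^{i+1}=(P^i)^p[P^i,P]$ (the descending $p$-central series) and $P_1=P$, $P_{i+1}=[P_i,P]$ (the descending central series). For a pair $\nu=(i,j)$ of integers with $i\ge j\ge 1$ put $P^{(\nu)}=(P^i\cap P_j)P^{i+1}$, and let $\nu+1=(i,j+1)$ if $i>j$ and $\nu+1=(i+1,1)$ if $i=j$. The quotient $P^{(\nu)}/P^{(\nu+1)}$ is an $\mathbb F_p$-vector space, and it is an $\mathbb F_p[G]$-module if $P=\mathcal F(d)$. Let $n,t\in\mathbb N$, $k\in\mathbb Z$, a finitely generated $\mathbb F_p[G]$-module $T$ and $\nu=(i,j)$ with $i\ge j\ge 1$ be given. Then there exists $m_0\ge n$ such that for all $m\ge m_0$ the following holds: for any elements $$x_1,\dots,x_t\in \hat H^k\bigl(G,\ \mathcal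 F(m)^{(\nu)}/\mathcal F(m)^{(\nu+1)}\otimes_{\mathbb F_p} T\bigr)$$ of the Tate cohomology group (with the diagonal action of $G$ on the tensor product) there exists a surjective continuous $G$-equivariant homomorphism $\psi:\mathcal F(m)\to\mathcal F(n)$ such that the induced homomorphism $$\psi_*:\hat H^k\bigl(G,\ \mathcal F(m)^{(\nu)}/\mathcal F(m)^{(\nu+1)}\otimes_{\mathbb F_p} T\bigr)\longrightarrow \hat H^k\bigl(G,\ \mathcal F(n)^{(\nu)}/\mathcal F(n)^{(\nu+1)}\otimes_{\mathbb F_p} T\bigr)$$ maps $x_1,\dots,x_t$ to zero. -/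

import Mathlib

open CategoryTheory MonoidalCategory
open scoped commutatorElement

/-! ### The pro-`p` completion of a discrete group -/

/-- The normal subgroups of `F` whose index is a (finite) power of `p`. -/
def PPowerNormal (p : ℕ) (F : Type) [Group F] : Type :=
  {N : Subgroup F // N.Normal ∧ ∃ a : ℕ, N.index = p ^ a}

namespace PPowerNormal

variable {p : ℕ} {F F' : Type} [Group F] [Group F']

instance (N : PPowerNormal p F) : N.1.Normal := N.2.1

/-- The quotient of `F` by `N`, a finite `p`-group, with the discrete topology. -/
def Quot (N : PPowerNormal p F) : Type := F ⧸ N.1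

instance (N : PPowerNormal p F) : Group N.Quot := inferInstanceAs (Group (F ⧸ N.1))

instance (N : PPowerNormal p F) : TopologicalSpace N.Quot := ⊥

instance (N : PPowerNormal p F) : DiscreteTopology N.Quot := ⟨rfl⟩

/-- The projection `F / N → F / M` for `N ≤ M`. -/
def proj {N M : PPowerNormal p F} (h : N.1 ≤ M.1) : N.Quot →* M.Quot :=
  QuotientGroup.map N.1 M.1 (MonoidHom.id F) h

variable [hp : Fact p.Prime]

/-- The preimage of a normal subgroup of `p`-power index. -/
def comap (α : F →* F') (N : PPowerNormal p F') : PPowerNormal p F :=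
  ⟨N.1.comap α, inferInstance, by
    obtain ⟨a, ha⟩ := N.2.2
    have h : (N.1.comap α).index ∣ p ^ a := by
      rw [Subgroup.index_comap, ← ha]
      exact Subgroup.relIndex_dvd_index_of_normal _ _
    obtain ⟨b, -, hb⟩ := (Nat.dvd_prime_pow hp.out).1 h
    exact ⟨b, hb⟩⟩

/-- The map `F / α⁻¹(N) → F' / N` induced by `α : F → F'`. -/
def quotMap (α : F →* F') (N : PPowerNormal p F') : (N.comap α).Quot →* N.Quot :=
  QuotientGroup.map (N.1.comap α) N.1 α le_rfl

end PPowerNormal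

/-- The pro-`p` completion of `F`: the inverse limit of the quotients of `F` by the normal
subgroups of `p`-power index, as a subgroup of their product. -/
def ProPCompletion (p : ℕ) (F : Type) [Group F] :
    Subgroup (∀ N : PPowerNormal p F, N.Quot) where
  carrier := {f | ∀ (N M : PPowerNormal p F) (h : N.1 ≤ M.1), PPowerNormal.proj h (f N) = f M}
  one_mem' _ _ _ := map_one _
  mul_mem' {f g} hf hg N M h := by
    rw [Pi.mul_apply, Pi.mul_apply, map_mul, hf N M h, hg N M h]
  inv_mem' {f} hf N M h := by
    rw [Pi.inv_apply, Pi.inv_apply, map_inv, hf N M h]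

namespace ProPCompletion

variable {p : ℕ} [Fact p.Prime] {F F' F'' : Type} [Group F] [Group F'] [Group F'']

/-- The pro-`p` completion is functorial. -/
def map (α : F →* F') : ProPCompletion p F →ₜ* ProPCompletion p F' where
  toFun f := ⟨fun N ↦ N.quotMap α (f.1 (N.comap α)), fun N M h ↦ by
    have hle : (N.comap α).1 ≤ (M.comap α).1 := Subgroup.comap_mono h
    change PPowerNormal.proj h (N.quotMap α (f.1 (N.comap α))) = M.quotMap α (f.1 (M.comap α))
    rw [← f.2 _ _ hle]
    generalize f.1 (N.comap α) = y
    obtain ⟨x, rfl⟩ := QuotientGroup.mk_surjective (s := (N.comap α).1) y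
    rfl⟩
  map_one' := Subtype.ext (funext fun _ ↦ map_one _)
  map_mul' _ _ := Subtype.ext (funext fun _ ↦ map_mul _ _ _)
  continuous_toFun := by
    refine Continuous.subtype_mk (continuous_pi fun N ↦ ?_) _
    exact (continuous_of_discreteTopology (f := N.quotMap α)).comp
      ((continuous_apply (N.comap α)).comp continuous_subtype_val)

lemma map_id_apply (f : ProPCompletion p F) : map (MonoidHom.id F) f = f := by
  refine Subtype.ext (funext fun N ↦ ?_)
  change N.quotMap (MonoidHom.id F) (f.1 (N.comap (MonoidHom.id F))) = f.1 N
  exact f.2 (N.comap (MonoidHom.id F)) N le_rfl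

lemma map_comp_apply (β : F' →* F'') (α : F →* F') (f : ProPCompletion p F) :
    map (β.comp α) f = map β (map α f) := by
  refine Subtype.ext (funext fun N ↦ ?_)
  change N.quotMap (β.comp α) (f.1 (N.comap (β.comp α))) =
    N.quotMap β ((N.comap β).quotMap α (f.1 ((N.comap β).comap α)))
  change N.quotMap (β.comp α) (f.1 ((N.comap β).comap α)) = _
  generalize f.1 ((N.comap β).comap α) = y
  obtain ⟨x, rfl⟩ := QuotientGroup.mk_surjective (s := ((N.comap β).comap α).1) y
  rfl

end ProPCompletion

/-! ### The free pro-`p`-`G` operator group of rank `d` -/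

/-- The free pro-`p`-`G` operator group of rank `d`: the free pro-`p` group on
`x_{i,g}`, `i = 1, …, d`, `g ∈ G`, that is, the pro-`p` completion of the free group of finite
rank on these letters. -/
abbrev FreeProPOperatorGroup (p : ℕ) (G : Type) (d : ℕ) : Type :=
  ProPCompletion p (FreeGroup (Fin d × G))

/-- The action of `G` on the discrete free group, `h` sending `x_{i,g}` to `x_{i,hg}`. -/
def freeGroupTranslate {G : Type} [Group G] (d : ℕ) (h : G) :
    FreeGroup (Fin d × G) →* FreeGroup (Fin d × G) :=
  FreeGroup.map fun x ↦ (x.1, h * x.2)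

/-- `G` acts by continuous automorphisms, `h` sending `x_{i,g}` to `x_{i,hg}`. -/
noncomputable instance FreeProPOperatorGroup.instMulDistribMulAction (p : ℕ) [Fact p.Prime]
    (G : Type) [Group G] (d : ℕ) :
    MulDistribMulAction G (FreeProPOperatorGroup p G d) where
  smul h f := ProPCompletion.map (freeGroupTranslate d h) f
  one_smul f := by
    have h1 : freeGroupTranslate d (1 : G) = MonoidHom.id _ := by
      ext x; simp [freeGroupTranslate]
    change ProPCompletion.map (freeGroupTranslate d (1 : G)) f = f
    rw [h1, ProPCompletion.map_id_apply]
  mul_smul g h f := by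
    have h1 : freeGroupTranslate d (g * h) =
        (freeGroupTranslate d g).comp (freeGroupTranslate d h) := by
      ext x; simp [freeGroupTranslate, mul_assoc]
    change ProPCompletion.map (freeGroupTranslate d (g * h)) f =
      ProPCompletion.map (freeGroupTranslate d g) (ProPCompletion.map (freeGroupTranslate d h) f)
    rw [h1, ProPCompletion.map_comp_apply]
  smul_mul h _ _ := map_mul (ProPCompletion.map (freeGroupTranslate d h)) _ _
  smul_one h := map_one (ProPCompletion.map (freeGroupTranslate d h))

instance FreeProPOperatorGroup.instContinuousConstSMul (p : ℕ) [Fact p.Prime]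
    (G : Type) [Group G] (d : ℕ) :
    ContinuousConstSMul G (FreeProPOperatorGroup p G d) where
  continuous_const_smul h := (ProPCompletion.map (freeGroupTranslate d h)).continuous_toFun

/-! ### The descending `p`-central series and its refinement -/

section Filtration

variable (p : ℕ) (P : Type) [Group P] [TopologicalSpace P] [IsTopologicalGroup P]

/-- The descending `p`-central series `P^i`, `i ≥ 1` (closed subgroups):
`P^1 = P` and `P^{i+1} = (P^i)^p [P^i, P]`. The value at `0` plays no role. -/
def descPCentral : ℕ → Subgroup P
  | 0 => ⊤
  | 1 => ⊤
  | i + 2 => (Subgroup.closure ((fun x ↦ x ^ p) '' (descPCentral (i + 1) : Set P)) ⊔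
      ⁅descPCentral (i + 1), (⊤ : Subgroup P)⁆).topologicalClosure

/-- The descending central series `P_i`, `i ≥ 1` (closed subgroups):
`P_1 = P` and `P_{i+1} = [P_i, P]`. The value at `0` plays no role. -/
def descCentral : ℕ → Subgroup P
  | 0 => ⊤
  | 1 => ⊤
  | i + 2 => ⁅descCentral (i + 1), (⊤ : Subgroup P)⁆.topologicalClosure

/-- The pairs `ν = (i, j)` with `i ≥ j ≥ 1`. -/
@[ext]
structure FiltIndex where
  i : ℕ
  j : ℕ
  one_le_j : 1 ≤ j
  j_le_i : j ≤ i

/-- `ν + 1` is `(i, j + 1)` if `i > j`, and `(i + 1, 1)` if `i = j`. -/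
def FiltIndex.next (ν : FiltIndex) : FiltIndex :=
  if h : ν.j < ν.i then ⟨ν.i, ν.j + 1, by omega, h⟩ else ⟨ν.i + 1, 1, le_rfl, by omega⟩

/-- The refinement `P^{(i,j)} = (P^i ∩ P_j) P^{i+1}`. -/
def refinedSeries (ν : FiltIndex) : Subgroup P :=
  (descPCentral p P ν.i ⊓ descCentral P ν.j) ⊔ descPCentral p P (ν.i + 1)

set_option linter.unusedSectionVars false

variable {P} {Q : Type} [Group Q] [TopologicalSpace Q] [IsTopologicalGroup Q]

lemma map_topologicalClosure_le_of_map_le (φ : P →ₜ* Q) {H : Subgroup P} {K : Subgroup Q}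
    (h : H ≤ K.comap φ.toMonoidHom) :
    H.topologicalClosure ≤ K.topologicalClosure.comap φ.toMonoidHom := by
  refine H.topologicalClosure_minimal (fun x hx ↦ K.le_topologicalClosure (h hx)) ?_
  exact K.isClosed_topologicalClosure.preimage φ.continuous_toFun

lemma commutator_top_le_comap (φ : P →ₜ* Q) {H : Subgroup P} {K : Subgroup Q}
    (h : H ≤ K.comap φ.toMonoidHom) :
    ⁅H, (⊤ : Subgroup P)⁆ ≤ ⁅K, (⊤ : Subgroup Q)⁆.comap φ.toMonoidHom := by
  rw [← Subgroup.map_le_iff_le_comap, Subgroup.map_commutator]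
  exact Subgroup.commutator_mono (Subgroup.map_le_iff_le_comap.2 h) le_top

lemma descPCentral_le_comap (φ : P →ₜ* Q) :
    ∀ i, descPCentral p P i ≤ (descPCentral p Q i).comap φ.toMonoidHom
  | 0 => fun _ _ ↦ trivial
  | 1 => fun _ _ ↦ trivial
  | i + 2 => by
    have ih := descPCentral_le_comap φ (i + 1)
    refine map_topologicalClosure_le_of_map_le φ (sup_le ?_ ?_)
    · rw [Subgroup.closure_le]
      rintro _ ⟨x, hx, rfl⟩
      refine Subgroup.mem_sup_left (Subgroup.subset_closure ⟨φ x, ih hx, ?_⟩)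
      exact (map_pow φ x p).symm
    · exact (commutator_top_le_comap φ ih).trans (Subgroup.comap_mono le_sup_right)

lemma descCentral_le_comap (φ : P →ₜ* Q) :
    ∀ i, descCentral P i ≤ (descCentral Q i).comap φ.toMonoidHom
  | 0 => fun _ _ ↦ trivial
  | 1 => fun _ _ ↦ trivial
  | i + 2 => map_topologicalClosure_le_of_map_le φ
      (commutator_top_le_comap φ (descCentral_le_comap φ (i + 1)))

lemma refinedSeries_le_comap (φ : P →ₜ* Q) (ν : FiltIndex) :
    refinedSeries p P ν ≤ (refinedSeries p Q ν).comap φ.toMonoidHom :=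
  sup_le (fun _ hx ↦ Subgroup.mem_sup_left
      ⟨descPCentral_le_comap p φ _ hx.1, descCentral_le_comap φ _ hx.2⟩)
    (fun _ hx ↦ Subgroup.mem_sup_right (descPCentral_le_comap p φ _ hx))

/-- Conjugation by `x` as a continuous endomorphism. -/
def conjHom (x : P) : P →ₜ* P where
  toMonoidHom := (MulAut.conj x).toMonoidHom
  continuous_toFun := by
    change Continuous fun y ↦ x * y * x⁻¹
    fun_prop

instance descPCentral_normal (i : ℕ) : (descPCentral p P i).Normal :=
  ⟨fun _ hn x ↦ descPCentral_le_comap p (conjHom x) i hn⟩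

instance refinedSeries_normal (ν : FiltIndex) : (refinedSeries p P ν).Normal :=
  ⟨fun _ hn x ↦ refinedSeries_le_comap p (conjHom x) ν hn⟩

lemma pow_mem_descPCentral_succ {i : ℕ} (hi : 1 ≤ i) {x : P} (hx : x ∈ descPCentral p P i) :
    x ^ p ∈ descPCentral p P (i + 1) := by
  obtain ⟨i, rfl⟩ := Nat.exists_eq_add_of_le' hi
  exact Subgroup.le_topologicalClosure _
    (Subgroup.mem_sup_left (Subgroup.subset_closure ⟨x, hx, rfl⟩))

lemma commutator_mem_descPCentral_succ {i : ℕ} (hi : 1 ≤ i) {x : P}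
    (hx : x ∈ descPCentral p P i) (y : P) : ⁅x, y⁆ ∈ descPCentral p P (i + 1) := by
  obtain ⟨i, rfl⟩ := Nat.exists_eq_add_of_le' hi
  exact Subgroup.le_topologicalClosure _
    (Subgroup.mem_sup_right (Subgroup.commutator_mem_commutator hx (Subgroup.mem_top y)))

lemma descPCentral_succ_le : ∀ i, descPCentral p P (i + 1) ≤ descPCentral p P i
  | 0 => le_top
  | 1 => le_top
  | i + 2 => by
    have ih := descPCentral_succ_le (i + 1)
    refine Subgroup.topologicalClosure_mono (sup_le_sup ?_ (Subgroup.commutator_mono ih le_rfl))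
    exact Subgroup.closure_mono (Set.image_mono ih)

lemma refinedSeries_le (ν : FiltIndex) : refinedSeries p P ν ≤ descPCentral p P ν.i :=
  sup_le inf_le_left (descPCentral_succ_le p ν.i)

lemma descPCentral_succ_le_refinedSeries_next (ν : FiltIndex) :
    descPCentral p P (ν.i + 1) ≤ refinedSeries p P ν.next := by
  unfold FiltIndex.next
  split_ifs
  · exact le_sup_right
  · exact le_sup_of_le_left (le_inf le_rfl le_top)

variable (P) in
/-- The quotient `P^{(ν)} / P^{(ν+1)}`, as a multiplicative group. -/
def GradedPiece (ν : FiltIndex) : Type :=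
  refinedSeries p P ν ⧸ (refinedSeries p P ν.next).subgroupOf (refinedSeries p P ν)

instance (ν : FiltIndex) : CommGroup (GradedPiece p P ν) :=
  { (inferInstance : Group (refinedSeries p P ν ⧸
      (refinedSeries p P ν.next).subgroupOf (refinedSeries p P ν))) with
    mul_comm := by
      intro a b
      obtain ⟨x, rfl⟩ := QuotientGroup.mk_surjective a
      obtain ⟨y, rfl⟩ := QuotientGroup.mk_surjective b
      refine QuotientGroup.eq.2 ?_
      have h : ((x * y)⁻¹ * (y * x) : P) = ⁅(y⁻¹ : P), (x⁻¹ : P)⁆ := by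
        simp [commutatorElement_def, mul_assoc]
      rw [Subgroup.mem_subgroupOf]
      change ((x * y)⁻¹ * (y * x) : P) ∈ _
      rw [h]
      exact descPCentral_succ_le_refinedSeries_next p ν
        (commutator_mem_descPCentral_succ p (ν.one_le_j.trans ν.j_le_i)
          (inv_mem (refinedSeries_le p ν y.2)) _) }

/-- `P^{(ν)} / P^{(ν+1)}`, written additively, is an `𝔽_p`-vector space. -/
instance (ν : FiltIndex) : Module (ZMod p) (Additive (GradedPiece p P ν)) :=
  AddCommGroup.zmodModule <| by
    intro a
    obtain ⟨x, hx⟩ := QuotientGroup.mk_surjective (Additive.toMul a)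
    obtain rfl : a = Additive.ofMul (QuotientGroup.mk x : GradedPiece p P ν) := hx.symm
    exact (QuotientGroup.eq_one_iff (x ^ p)).2 (descPCentral_succ_le_refinedSeries_next p ν
      (pow_mem_descPCentral_succ p (ν.one_le_j.trans ν.j_le_i) (refinedSeries_le p ν x.2)))

/-- The map `P^{(ν)} / P^{(ν+1)} → Q^{(ν)} / Q^{(ν+1)}` induced by a continuous homomorphism. -/
def GradedPiece.map (φ : P →ₜ* Q) (ν : FiltIndex) : GradedPiece p P ν →* GradedPiece p Q ν :=
  QuotientGroup.map _ _
    ((φ.toMonoidHom.comp (refinedSeries p P ν).subtype).codRestrict (refinedSeries p Q ν)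
      fun x ↦ refinedSeries_le_comap p φ ν x.2)
    fun x hx ↦ refinedSeries_le_comap p φ ν.next (x := (x : P)) hx

/-- The same map as an `𝔽_p`-linear map. -/
def GradedPiece.linearMap (φ : P →ₜ* Q) (ν : FiltIndex) :
    Additive (GradedPiece p P ν) →ₗ[ZMod p] Additive (GradedPiece p Q ν) :=
  (GradedPiece.map p φ ν).toAdditive.toZModLinearMap p

variable (G : Type) [Group G] [MulDistribMulAction G P] [ContinuousConstSMul G P]

variable (P) in
/-- The action of `g ∈ G` as a continuous endomorphism. -/
def smulHom (g : G) : P →ₜ* P where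
  toMonoidHom := MulDistribMulAction.toMonoidHom P g
  continuous_toFun := continuous_const_smul g

variable (P) in
/-- `P^{(ν)} / P^{(ν+1)}` as an `𝔽_p[G]`-module. -/
def gradedRep (ν : FiltIndex) : Rep (ZMod p) G :=
  Rep.of (X := Additive (GradedPiece p P ν))
    { toFun := fun g ↦ GradedPiece.linearMap p (smulHom P G g) ν
      map_one' := by
        ext a
        obtain ⟨x, rfl⟩ := QuotientGroup.mk_surjective (Additive.toMul a)
        exact congrArg QuotientGroup.mk (Subtype.ext (one_smul G (x : P)))
      map_mul' := fun g h ↦ by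
        ext a
        obtain ⟨x, rfl⟩ := QuotientGroup.mk_surjective (Additive.toMul a)
        exact congrArg QuotientGroup.mk (Subtype.ext (mul_smul g h (x : P))) }

variable {G} [MulDistribMulAction G Q] [ContinuousConstSMul G Q]

/-- The `𝔽_p[G]`-homomorphism `P^{(ν)} / P^{(ν+1)} → Q^{(ν)} / Q^{(ν+1)}` induced by a continuous
`G`-equivariant homomorphism `P → Q`. -/
def gradedRepMap (φ : P →ₜ* Q) (hφ : ∀ (g : G) (x : P), φ (g • x) = g • φ x) (ν : FiltIndex) :
    gradedRep p P G ν ⟶ gradedRep p Q G ν :=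
  Rep.ofHom
    { GradedPiece.linearMap p φ ν with
      isIntertwining' := fun g ↦ by
        ext a
        obtain ⟨x, rfl⟩ := QuotientGroup.mk_surjective (Additive.toMul a)
        exact congrArg QuotientGroup.mk (Subtype.ext (hφ g (x : P))) }

end Filtration

/-! Take `m ≥ r * n` and arrange `r * n` of the generators into `r` blocks, each a copy of a basis
of `F(n)`. For a set `S` of blocks let `ψ_S : F(m) → F(n)` copy the blocks in `S` onto the basis of
`F(n)` and kill all other generators. It is equivariant, trivial for `S = ∅`, and split surjective
for `S ≠ ∅`. It remains to find `S ≠ ∅` for which `ψ_S` kills all `x a`.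

View `S` as a point of `{0,1}^r`. The graded piece of `F(n)` only sees a finite `p`-group quotient
`Q` of the free group. In `𝔽_p[Q]` a switched letter is `1 + s (u - 1)` with `s ∈ {0,1}`; expanding
a word, the coefficient of a monomial in `e` variables has depth at least `e` in a finite
multiplicative filtration. So the image of a fixed element is a polynomial in `S` whose degree is
bounded in terms of `Q` only, not of `m`, `r` or the word (`IsPGroup.exists_hasBoolDegreeLE`).
Additive functors preserve such bounds (`Rep.hasBoolDegreeLE_map`), so they hold in Tate cohomology
too.

The target cohomology has finite dimension, so killing `t` classes means solving boundedly many
equations of bounded degree. They have the solution `∅`; once `r` is large, a Chevalley–Warning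
argument on `{0,1}^r` gives another one (`HasBoolDegreeLE.exists_nonempty_forall_eq_zero`). -/

open Finset in
/-- A function on the finite subsets of `ι`, regarded as a function of `0/1`-valued variables,
is given by a multilinear polynomial of degree at most `d`. -/
def HasBoolDegreeLE {ι M : Type*} [AddCommMonoid M] (d : ℕ) (f : Finset ι → M) : Prop :=
  ∃ a : Finset ι → M, (∀ U, d < #U → a U = 0) ∧ ∀ S, f S = ∑ U ∈ S.powerset, a U

/-! ### Multilinear polynomials in `0/1`-valued variables and Chevalley–Warning -/

namespace HasBoolDegreeLE

open Finset

variable {ι : Type*}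

/-- The variables are idempotent, so the monomials of `U` and `V` multiply to that of `U ∪ V`; terms
are collected by this union. -/
lemma sum_powerset_mul_sum_powerset [DecidableEq ι] {R : Type*} [NonUnitalNonAssocSemiring R]
    (a b : Finset ι → R) (S : Finset ι) :
    (∑ U ∈ S.powerset, a U) * ∑ U ∈ S.powerset, b U =
      ∑ W ∈ S.powerset, ∑ x ∈ (W.powerset ×ˢ W.powerset).filter (fun x ↦ x.1 ∪ x.2 = W),
        a x.1 * b x.2 := by
  rw [sum_mul_sum, ← sum_product', ← sum_fiberwise_of_maps_to (g := fun x ↦ x.1 ∪ x.2)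
    (t := S.powerset)]
  · refine sum_congr rfl fun W hW ↦ sum_congr ?_ fun _ _ ↦ rfl
    ext x
    simp only [mem_filter, mem_product, mem_powerset] at hW ⊢
    constructor
    · rintro ⟨-, rfl⟩
      exact ⟨⟨subset_union_left, subset_union_right⟩, rfl⟩
    · rintro ⟨⟨h1, h2⟩, h⟩
      exact ⟨⟨h1.trans hW, h2.trans hW⟩, h⟩
  · simp only [mem_product, mem_powerset]
    exact fun x hx ↦ union_subset hx.1 hx.2

/-- Möbius inversion on the subset lattice, with the coefficients defined recursively. -/
lemma exists_eq_sum_powerset [DecidableEq ι] {M : Type*} [AddCommGroup M] (f : Finset ι → M) :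
    ∃ a : Finset ι → M, ∀ S, f S = ∑ U ∈ S.powerset, a U := by
  let a : Finset ι → M := fun S ↦ Finset.strongInduction
    (fun S ih ↦ f S - ∑ U ∈ S.ssubsets.attach, ih U.1 (mem_ssubsets.1 U.2)) S
  refine ⟨a, fun S ↦ ?_⟩
  have h : a S = f S - ∑ U ∈ S.ssubsets, a U := by
    rw [← sum_attach S.ssubsets]
    exact Finset.strongInduction_eq _ _
  rw [← add_sum_erase _ _ (mem_powerset_self S), h]
  exact (sub_add_cancel _ _).symm

lemma eq_of_sum_powerset_eq [DecidableEq ι] {M : Type*} [AddCommGroup M] {a b : Finset ι → M}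
    (h : ∀ S : Finset ι, ∑ U ∈ S.powerset, a U = ∑ U ∈ S.powerset, b U) (S : Finset ι) :
    a S = b S := by
  induction S using Finset.strongInduction with
  | H S ih =>
    have hS := h S
    have hlt : ∑ U ∈ S.powerset.erase S, a U = ∑ U ∈ S.powerset.erase S, b U :=
      sum_congr rfl fun U hU ↦ ih U (mem_ssubsets.1 hU)
    rw [← add_sum_erase _ _ (mem_powerset_self S), ← add_sum_erase _ b (mem_powerset_self S),
      hlt] at hS
    exact add_right_cancel hS

lemma map {M N : Type*} [AddCommMonoid M] [AddCommMonoid N] {d : ℕ} {f : Finset ι → M}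
    (hf : HasBoolDegreeLE d f) (φ : M →+ N) : HasBoolDegreeLE d fun S ↦ φ (f S) := by
  obtain ⟨a, ha, h⟩ := hf
  exact ⟨fun U ↦ φ (a U), fun U hU ↦ by simp [ha U hU], fun S ↦ by simp [h]⟩

lemma const {M : Type*} [AddCommMonoid M] (d : ℕ) (c : M) :
    HasBoolDegreeLE d fun _ : Finset ι ↦ c := by
  classical
  refine ⟨fun U ↦ if U = ∅ then c else 0, fun U hU ↦ if_neg ?_, fun S ↦ ?_⟩
  · rintro rfl
    simp at hU
  · simp

lemma sub {M : Type*} [AddCommGroup M] {d : ℕ} {f g : Finset ι → M}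
    (hf : HasBoolDegreeLE d f) (hg : HasBoolDegreeLE d g) :
    HasBoolDegreeLE d fun S ↦ f S - g S := by
  obtain ⟨a, ha, h⟩ := hf
  obtain ⟨b, hb, h'⟩ := hg
  exact ⟨fun U ↦ a U - b U, fun U hU ↦ by simp [ha U hU, hb U hU], fun S ↦ by simp [h, h']⟩

lemma mul [DecidableEq ι] {R : Type*} [NonUnitalNonAssocSemiring R] {d e : ℕ} {f g : Finset ι → R}
    (hf : HasBoolDegreeLE d f) (hg : HasBoolDegreeLE e g) :
    HasBoolDegreeLE (d + e) fun S ↦ f S * g S := by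
  obtain ⟨a, ha, h⟩ := hf
  obtain ⟨b, hb, h'⟩ := hg
  refine ⟨fun W ↦ ∑ x ∈ (W.powerset ×ˢ W.powerset).filter (fun x ↦ x.1 ∪ x.2 = W),
    a x.1 * b x.2, fun W hW ↦ sum_eq_zero fun x hx ↦ ?_, fun S ↦ ?_⟩
  swap
  · simp only [h, h', sum_powerset_mul_sum_powerset]
  obtain rfl := (mem_filter.1 hx).2
  have := card_union_le x.1 x.2
  rcases lt_or_ge d #x.1 with h1 | h1
  · rw [ha _ h1, zero_mul]
  · rw [hb _ (by omega), mul_zero]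

lemma pow [DecidableEq ι] {R : Type*} [Semiring R] {d : ℕ} {f : Finset ι → R}
    (hf : HasBoolDegreeLE d f) (n : ℕ) : HasBoolDegreeLE (d * n) fun S ↦ f S ^ n := by
  induction n with
  | zero => simpa using const 0 (1 : R)
  | succ n ih => simpa only [pow_succ, mul_add, mul_one] using ih.mul hf

lemma prod [DecidableEq ι] {R κ : Type*} [CommSemiring R] {d : ℕ} {f : κ → Finset ι → R}
    (s : Finset κ) (hf : ∀ l, HasBoolDegreeLE d (f l)) :
    HasBoolDegreeLE (d * #s) fun S ↦ ∏ l ∈ s, f l S := by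
  classical
  induction s using Finset.induction with
  | empty => simpa using const 0 (1 : R)
  | insert l s hl ih =>
    simpa only [prod_insert hl, card_insert_of_notMem hl, mul_add, mul_one, add_comm] using
      (hf l).mul ih

/-- A function of small degree which does not vanish at `∅` has another nonzero value. -/
lemma exists_nonempty_ne_zero [DecidableEq ι] [Fintype ι] {M : Type*} [AddCommGroup M] {d : ℕ}
    {f : Finset ι → M} (hf : HasBoolDegreeLE d f) (hd : d < Fintype.card ι) (h0 : f ∅ ≠ 0) :
    ∃ S : Finset ι, S.Nonempty ∧ f S ≠ 0 := by
  by_contra! H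
  obtain ⟨a, ha, h⟩ := hf
  -- Now `f` is `f ∅` times the indicator of `∅`, which is the product of all `1 - s_i`; its top
  -- coefficient is nonzero, against the degree bound.
  have key : a univ = (-1 : ℤ) ^ #(univ : Finset ι) • f ∅ := by
    refine eq_of_sum_powerset_eq (b := fun U ↦ (-1 : ℤ) ^ #U • f ∅) (fun S ↦ ?_) univ
    rw [← h, ← sum_smul, sum_powerset_neg_one_pow_card]
    split_ifs with hS
    · rw [hS, one_smul]
    · rw [zero_smul, H S (nonempty_iff_ne_empty.2 hS)]
  rw [ha _ (by simpa using hd)] at key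
  rcases neg_one_pow_eq_or ℤ #(univ : Finset ι) with h1 | h1 <;> rw [h1] at key <;>
    simp_all

/-- A Chevalley–Warning theorem for `0/1`-valued variables. -/
lemma exists_nonempty_forall_eq_zero [DecidableEq ι] [Fintype ι] {p : ℕ} [Fact p.Prime]
    {κ : Type*} [Fintype κ] {d : ℕ} {f : κ → Finset ι → ZMod p}
    (hf : ∀ l, HasBoolDegreeLE d (f l)) (h0 : ∀ l, f l ∅ = 0)
    (hd : d * (p - 1) * Fintype.card κ < Fintype.card ι) :
    ∃ S : Finset ι, S.Nonempty ∧ ∀ l, f l S = 0 := by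
  have hp : p - 1 ≠ 0 := Nat.sub_ne_zero_of_lt (Fact.out : p.Prime).one_lt
  -- The product of the `1 - f_l ^ (p - 1)` is the indicator of the common zeros of the `f_l`, and
  -- equals `1` at `∅`.
  obtain ⟨S, hS, h⟩ := exists_nonempty_ne_zero
    (prod univ fun l ↦ (const (d * (p - 1)) (1 : ZMod p)).sub ((hf l).pow (p - 1))) hd
    (by simp [h0, hp])
  refine ⟨S, hS, fun l ↦ ?_⟩
  by_contra hl
  exact prod_ne_zero_iff.1 h l (mem_univ l) (by rw [ZMod.pow_card_sub_one_eq_one hl, sub_self])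

/-- In coordinates, each vector equation becomes `finrank V` scalar ones. -/
lemma exists_nonempty_forall_eq_zero_of_finite [DecidableEq ι] [Fintype ι] {p : ℕ} [Fact p.Prime]
    {κ V : Type*} [Fintype κ] [AddCommGroup V] [Module (ZMod p) V] [Module.Finite (ZMod p) V]
    {d : ℕ} {f : κ → Finset ι → V} (hf : ∀ l, HasBoolDegreeLE d (f l)) (h0 : ∀ l, f l ∅ = 0)
    (hd : d * (p - 1) * (Fintype.card κ * Module.finrank (ZMod p) V) < Fintype.card ι) :
    ∃ S : Finset ι, S.Nonempty ∧ ∀ l, f l S = 0 := by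
  let b := Module.finBasis (ZMod p) V
  obtain ⟨S, hS, h⟩ := exists_nonempty_forall_eq_zero (κ := κ × Fin (Module.finrank (ZMod p) V))
    (f := fun l S ↦ b.coord l.2 (f l.1 S)) (d := d)
    (fun l ↦ (hf l.1).map (b.coord l.2).toAddMonoidHom) (fun l ↦ by simp [h0]) (by simpa using hd)
  exact ⟨S, hS, fun l ↦ b.forall_coord_eq_zero_iff.1 fun c ↦ h (l, c)⟩

end HasBoolDegreeLE

/-! ### Words in finite `p`-groups as polynomials of bounded degree -/

section PGroup

open MonoidAlgebra

variable {p : ℕ} {Q M : Type*} [Group Q] [AddCommGroup M] [Module (MonoidAlgebra (ZMod p) Q) M]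

/-- The preimage of the `Q`-invariants of `M / W`. -/
def Submodule.invariantsModulo (W : Submodule (MonoidAlgebra (ZMod p) Q) M) :
    Submodule (MonoidAlgebra (ZMod p) Q) M where
  carrier := {m | ∀ q : Q, of (ZMod p) Q q • m - m ∈ W}
  add_mem' {a b} ha hb q := by
    simpa only [smul_add, add_sub_add_comm] using W.add_mem (ha q) (hb q)
  zero_mem' q := by simp
  smul_mem' c m hm q := by
    induction c using MonoidAlgebra.induction_on with
    | of h =>
      have : of (ZMod p) Q q • of (ZMod p) Q h • m - of (ZMod p) Q h • m =
          of (ZMod p) Q h • (of (ZMod p) Q (h⁻¹ * q * h) • m - m) := by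
        rw [smul_sub, smul_smul, smul_smul, ← map_mul, ← map_mul, mul_assoc, mul_inv_cancel_left]
      rw [this]
      exact W.smul_mem _ (hm _)
    | add f g hf hg =>
      simpa only [add_smul, smul_add, add_sub_add_comm] using W.add_mem hf hg
    | smul r f hf =>
      have : of (ZMod p) Q q • (r • f) • m - (r • f) • m =
          (r • (1 : MonoidAlgebra (ZMod p) Q)) • (of (ZMod p) Q q • f • m - f • m) := by
        simp only [smul_sub, smul_smul, smul_mul_assoc, mul_smul_comm, one_mul]
      rw [this]
      exact W.smul_mem _ hf

lemma Submodule.le_invariantsModulo (W : Submodule (MonoidAlgebra (ZMod p) Q) M) :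
    W ≤ W.invariantsModulo :=
  fun _ hm _ ↦ W.sub_mem (W.smul_mem _ hm) hm

/-- A `p`-group acting on a nonzero finite `𝔽_p`-space, here `M / W`, has a nonzero fixed vector,
since the number of fixed points is divisible by `p`. -/
lemma Submodule.lt_invariantsModulo [Fact p.Prime] [Finite M] (hQ : IsPGroup p Q)
    {W : Submodule (MonoidAlgebra (ZMod p) Q) M} (hW : W ≠ ⊤) : W < W.invariantsModulo := by
  refine lt_of_le_of_ne W.le_invariantsModulo fun h ↦ ?_
  let : MulAction Q (M ⧸ W) := MulAction.compHom _ (of (ZMod p) Q)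
  have : Finite (M ⧸ W) := Quotient.finite _
  have : Nontrivial (M ⧸ W) := Submodule.Quotient.nontrivial_iff.2 hW
  have hcard : p ∣ Nat.card (M ⧸ W) := by
    let : Module (ZMod p) (M ⧸ W) := Module.compHom _ (algebraMap (ZMod p) (MonoidAlgebra (ZMod p) Q))
    obtain ⟨y, hy⟩ := exists_ne (0 : M ⧸ W)
    have hpy : p • y = 0 := by
      rw [← Nat.cast_smul_eq_nsmul (ZMod p), CharP.cast_eq_zero, zero_smul]
    have h := addOrderOf_dvd_natCard y
    rwa [addOrderOf_eq_prime hpy hy] at h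
  obtain ⟨b, hb, hb0⟩ := hQ.exists_fixed_point_of_prime_dvd_card_of_fixed_point (M ⧸ W) hcard
    (a := 0) (fun q ↦ smul_zero (of (ZMod p) Q q))
  obtain ⟨m, rfl⟩ := W.mkQ_surjective b
  refine hb0 ((Submodule.Quotient.mk_eq_zero W).2 ?_).symm
  rw [h]
  exact fun q ↦ (Submodule.Quotient.eq W).1 (hb q)

lemma IsPGroup.exists_iterate_invariantsModulo_eq_top [Fact p.Prime] [Finite M]
    (hQ : IsPGroup p Q) :
    ∃ n : ℕ, (Submodule.invariantsModulo^[n] (⊥ : Submodule (MonoidAlgebra (ZMod p) Q) M)) = ⊤ := by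
  by_contra! H
  have : StrictMono fun n : ℕ ↦
      Submodule.invariantsModulo^[n] (⊥ : Submodule (MonoidAlgebra (ZMod p) Q) M) :=
    strictMono_nat_of_lt_succ fun n ↦ by
      rw [Function.iterate_succ_apply']
      exact Submodule.lt_invariantsModulo hQ (H n)
  exact not_injective_infinite_finite _ this.injective

/-- The group algebra of a finite `p`-group over `𝔽_p` has a finite decreasing multiplicative
filtration with `q - 1` in the first step for all `q`. -/
lemma IsPGroup.exists_filtration [Fact p.Prime] [Finite Q] (hQ : IsPGroup p Q) :
    ∃ (N : ℕ) (J : ℕ → AddSubgroup (MonoidAlgebra (ZMod p) Q)), Antitone J ∧ 1 ∈ J 0 ∧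
      (∀ m n x y, x ∈ J m → y ∈ J n → x * y ∈ J (m + n)) ∧
      (∀ q, of (ZMod p) Q q - 1 ∈ J 1) ∧ J N = ⊥ := by
  have : Finite (MonoidAlgebra (ZMod p) Q) := Module.finite_of_finite (ZMod p)
  obtain ⟨N, hN⟩ := hQ.exists_iterate_invariantsModulo_eq_top (M := MonoidAlgebra (ZMod p) Q)
  let W (n : ℕ) := Submodule.invariantsModulo^[n]
    (⊥ : Submodule (MonoidAlgebra (ZMod p) Q) (MonoidAlgebra (ZMod p) Q))
  have hW : Monotone W := monotone_nat_of_le_succ fun n ↦ by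
    simp only [W, Function.iterate_succ_apply']
    exact Submodule.le_invariantsModulo _
  -- `J n` consists of the elements lowering the series `W` by `n` steps, which makes
  -- multiplicativity formal. As `1 ∈ W N = ⊤` and `W 0 = ⊥`, it vanishes for `n = N`.
  let J (n : ℕ) : AddSubgroup (MonoidAlgebra (ZMod p) Q) :=
    { carrier := {x | ∀ k, ∀ m ∈ W (n + k), x * m ∈ W k}
      add_mem' := fun ha hb k m hm ↦ by
        rw [add_mul]
        exact (W k).add_mem (ha k m hm) (hb k m hm)
      zero_mem' := fun k m _ ↦ by simp
      neg_mem' := fun ha k m hm ↦ by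
        rw [neg_mul]
        exact (W k).neg_mem (ha k m hm) }
  refine ⟨N, J, fun m n h x hx k w hw ↦ hx k w (hW (by omega) hw), fun k m hm ↦ ?_,
    fun m n x y hx hy k w hw ↦ ?_, fun q k m hm ↦ ?_, ?_⟩
  · simpa using hm
  · rw [mul_assoc]
    exact hx k _ (hy _ w (by convert hw using 2; omega))
  · rw [sub_mul, one_mul]
    rw [add_comm] at hm
    simp only [W, Function.iterate_succ_apply'] at hm
    exact hm q
  · refine (AddSubgroup.eq_bot_iff_forall _).2 fun x hx ↦ ?_
    have : x * 1 ∈ W 0 := hx 0 1 (by simp [W, hN])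
    simpa [W] using this

open Finset in
/-- If the letters of a word are switched on and off by `0/1`-valued variables, then its value in
a finite `p`-group depends on these variables through polynomials of bounded degree. -/
theorem IsPGroup.exists_hasBoolDegreeLE [Fact p.Prime] [Finite Q] (hQ : IsPGroup p Q) :
    ∃ N : ℕ, ∀ {ι X V : Type} [DecidableEq ι] [AddCommGroup V] [Module (ZMod p) V]
      (ψ : Finset ι → FreeGroup X →* Q) (c : X → ι) (u : X → Q)
      (_ : ∀ x S, ψ S (.of x) = if c x ∈ S then u x else 1) (φ : Q → V) (w : FreeGroup X),
      HasBoolDegreeLE N fun S ↦ φ (ψ S w) := by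
  obtain ⟨N, J, hJ, h1, hmul, hof, hN⟩ := hQ.exists_filtration
  refine ⟨N, fun {ι X V} _ _ _ ψ c u hψ φ w ↦ ?_⟩
  -- A mere degree bound would grow with the length of `w`. Requiring the coefficient of `U` to lie
  -- in `J #U` is stable under products, and caps the degree because `J N = ⊥`.
  let A (f : Finset ι → MonoidAlgebra (ZMod p) Q) : Prop :=
    ∃ a : Finset ι → MonoidAlgebra (ZMod p) Q, (∀ U, a U ∈ J #U) ∧
      ∀ S, f S = ∑ U ∈ S.powerset, a U
  have A_mul {f g} (hf : A f) (hg : A g) : A fun S ↦ f S * g S := by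
    obtain ⟨a, ha, h⟩ := hf
    obtain ⟨b, hb, h'⟩ := hg
    refine ⟨fun W ↦ ∑ x ∈ (W.powerset ×ˢ W.powerset).filter (fun x ↦ x.1 ∪ x.2 = W),
      a x.1 * b x.2, fun W ↦ sum_mem fun x hx ↦ ?_, fun S ↦ ?_⟩
    · obtain rfl := (mem_filter.1 hx).2
      exact hJ (card_union_le _ _) (hmul _ _ _ _ (ha _) (hb _))
    · simp only [h, h', HasBoolDegreeLE.sum_powerset_mul_sum_powerset]
  have A_ite (i : ι) (q : Q) : A fun S ↦ of (ZMod p) Q (if i ∈ S then q else 1) := by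
    refine ⟨fun U ↦ if U = ∅ then 1 else if U = {i} then of (ZMod p) Q q - 1 else 0,
      fun U ↦ ?_, fun S ↦ ?_⟩
    · dsimp only
      split_ifs with h h'
      · simpa [h] using h1
      · simpa [h'] using hof q
      · exact zero_mem _
    · have (U : Finset ι) : (if U = ∅ then 1 else if U = {i} then of (ZMod p) Q q - 1 else 0) =
          (if U = ∅ then 1 else 0) + if U = {i} then of (ZMod p) Q q - 1 else 0 := by
        split_ifs with h h' h' <;> simp_all
      simp only [this, sum_add_distrib, sum_ite_eq', mem_powerset, empty_subset, if_true,
        singleton_subset_iff]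
      split_ifs <;> simp [one_def]
  have key : A fun S ↦ of (ZMod p) Q (ψ S w) := by
    induction w using FreeGroup.induction_on with
    | C1 =>
      refine ⟨fun U ↦ if U = ∅ then 1 else 0, fun U ↦ ?_, fun S ↦ ?_⟩
      · dsimp only
        split_ifs with h
        · simpa [h] using h1
        · exact zero_mem _
      · simp [one_def]
    | of x => simpa only [hψ] using A_ite (c x) (u x)
    | inv_of x _ =>
      have (S : Finset ι) : (if c x ∈ S then u x else 1)⁻¹ = if c x ∈ S then (u x)⁻¹ else 1 := by
        split_ifs <;> simp
      simpa only [map_inv, hψ, this] using A_ite (c x) (u x)⁻¹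
    | mul x y hx hy => simpa only [map_mul] using A_mul hx hy
  obtain ⟨a, ha, h⟩ := key
  have hdeg : HasBoolDegreeLE N fun S ↦ of (ZMod p) Q (ψ S w) :=
    ⟨a, fun U hU ↦ by simpa [hN] using hJ hU.le (ha U), h⟩
  -- `φ` is only a function, but it extends linearly to the group algebra.
  simpa using hdeg.map
    ((Finsupp.linearCombination (ZMod p) φ).comp
      (MonoidAlgebra.coeffLinearEquiv (ZMod p)).toLinearMap).toAddMonoidHom

end PGroup

/-! ### Finite `p`-quotients and open subgroups of the pro-`p` completion -/

namespace PPowerNormal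

variable {p : ℕ} {Γ : Type} [Group Γ]

lemma card_quot (N : PPowerNormal p Γ) : ∃ a : ℕ, Nat.card N.Quot = p ^ a := N.2.2

lemma isPGroup_quot (N : PPowerNormal p Γ) : IsPGroup p N.Quot :=
  let ⟨_, ha⟩ := N.card_quot
  IsPGroup.of_card ha

/-- The projection onto the quotient by `N`. -/
def mk' (N : PPowerNormal p Γ) : Γ →* N.Quot := QuotientGroup.mk' N.1

variable [hp : Fact p.Prime]

instance (N : PPowerNormal p Γ) : Finite N.Quot := by
  obtain ⟨a, ha⟩ := N.card_quot
  exact Nat.finite_of_card_ne_zero (ha ▸ pow_ne_zero _ hp.out.ne_zero)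

lemma exists_inf (M N : PPowerNormal p Γ) :
    ∃ K : PPowerNormal p Γ, K.1 = M.1 ⊓ N.1 := by
  obtain ⟨b, hb⟩ := N.2.2
  obtain ⟨a, ha⟩ := M.2.2
  obtain ⟨c, -, hc⟩ := (Nat.dvd_prime_pow hp.out).1
    (ha ▸ Subgroup.relIndex_dvd_index_of_normal M.1 N.1)
  exact ⟨⟨M.1 ⊓ N.1, inferInstance, c + b, by
    rw [← Subgroup.inf_relIndex_right] at hc
    rw [pow_add, ← hc, ← hb, Subgroup.relIndex_mul_index inf_le_right]⟩, rfl⟩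

lemma exists_le_of_finite {κ : Type*} (s : Finset κ) (N : κ → PPowerNormal p Γ) :
    ∃ K : PPowerNormal p Γ, ∀ i ∈ s, K.1 ≤ (N i).1 := by
  classical
  induction s using Finset.induction with
  | empty => exact ⟨⟨⊤, inferInstance, 0, by simp⟩, by simp⟩
  | insert i s _ ih =>
    obtain ⟨K, hK⟩ := ih
    obtain ⟨L, hL⟩ := exists_inf (N i) K
    refine ⟨L, fun j hj ↦ ?_⟩
    rw [hL]
    rcases Finset.mem_insert.1 hj with rfl | hj
    · exact inf_le_left
    · exact inf_le_right.trans (hK j hj)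

/-- A normal subgroup between `H` and `H ^ p [H, H]` of `p`-power index, in a finitely generated
group. -/
lemma exists_le_normalClosure_sup_commutator [Group.FG Γ] (N : PPowerNormal p Γ) :
    ∃ K : PPowerNormal p Γ,
      K.1 = Subgroup.normalClosure ((fun x ↦ x ^ p) '' (N.1 : Set Γ)) ⊔ ⁅N.1, N.1⁆ := by
  set K : Subgroup Γ := Subgroup.normalClosure ((fun x ↦ x ^ p) '' (N.1 : Set Γ)) ⊔ ⁅N.1, N.1⁆
  have hKN : K ≤ N.1 := by
    refine sup_le (Subgroup.normalClosure_le_normal ?_) (Subgroup.commutator_le_self _)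
    rintro _ ⟨x, hx, rfl⟩
    exact pow_mem hx p
  obtain ⟨a, ha⟩ := N.2.2
  -- By Schreier, `N` is finitely generated; so `N / K` is finitely generated abelian of exponent
  -- dividing `p`, hence finite.
  have : N.1.FiniteIndex := ⟨ha ▸ pow_ne_zero _ hp.out.ne_zero⟩
  let Q := N.1 ⧸ K.subgroupOf N.1
  let : CommGroup Q :=
    { (inferInstance : Group (N.1 ⧸ K.subgroupOf N.1)) with
      mul_comm := by
        intro a b
        obtain ⟨x, rfl⟩ := QuotientGroup.mk_surjective a
        obtain ⟨y, rfl⟩ := QuotientGroup.mk_surjective b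
        refine QuotientGroup.eq.2 ?_
        rw [Subgroup.mem_subgroupOf]
        have h : (((x * y)⁻¹ * (y * x) : N.1) : Γ) = ⁅(y⁻¹ : Γ), (x⁻¹ : Γ)⁆ := by
          simp [commutatorElement_def, mul_assoc]
        rw [h]
        exact Subgroup.mem_sup_right
          (Subgroup.commutator_mem_commutator (inv_mem y.2) (inv_mem x.2)) }
  have hpow (a : Q) : a ^ p = 1 := by
    obtain ⟨x, rfl⟩ := QuotientGroup.mk_surjective a
    refine (QuotientGroup.eq_one_iff (x ^ p)).2 ?_
    rw [Subgroup.mem_subgroupOf]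
    exact Subgroup.mem_sup_left (Subgroup.subset_normalClosure ⟨x, x.2, rfl⟩)
  have : Group.FG Q := QuotientGroup.fg _
  have : Finite Q := CommGroup.finite_of_fg_isMulTorsion Q fun a ↦
    isOfFinOrder_iff_pow_eq_one.2 ⟨p, hp.out.pos, hpow a⟩
  obtain ⟨b, hb⟩ := IsPGroup.iff_card.1 fun a : Q ↦ ⟨1, by rw [pow_one, hpow]⟩
  refine ⟨⟨K, inferInstance, b + a, ?_⟩, rfl⟩
  rw [← Subgroup.relIndex_mul_index hKN, ha, pow_add, ← hb]
  rfl

end PPowerNormal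

namespace ProPCompletion

variable {p : ℕ} {Γ : Type} [Group Γ]

/-- The canonical map to the pro-`p` completion. -/
def ofHom (p : ℕ) (Γ : Type) [Group Γ] : Γ →* ProPCompletion p Γ where
  toFun x := ⟨fun N ↦ N.mk' x, fun _ _ _ ↦ rfl⟩
  map_one' := rfl
  map_mul' _ _ := rfl

lemma exists_mk'_eq (f : ProPCompletion p Γ) (N : PPowerNormal p Γ) : ∃ x, N.mk' x = f.1 N :=
  QuotientGroup.mk_surjective _

lemma apply_eq_mk'_of_le (f : ProPCompletion p Γ) {N M : PPowerNormal p Γ} (h : N.1 ≤ M.1) {x : Γ}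
    (hx : f.1 N = N.mk' x) : f.1 M = M.mk' x := by
  rw [← f.2 N M h, hx]
  rfl

lemma isClosed_descPCentral (P : Type) [Group P] [TopologicalSpace P] [IsTopologicalGroup P] :
    ∀ k, IsClosed (descPCentral p P k : Set P)
  | 0 => isClosed_univ
  | 1 => isClosed_univ
  | _ + 2 => Subgroup.isClosed_topologicalClosure _

variable [hp : Fact p.Prime]

/-- A closed subgroup which contains the image of `N` contains the kernel of the projection to
the quotient by `N`. -/
lemma mem_of_apply_eq_one {C : Subgroup (ProPCompletion p Γ)} (hC : IsClosed (C : Set (ProPCompletion p Γ)))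
    {N : PPowerNormal p Γ} (hN : N.1 ≤ C.comap (ofHom p Γ)) {f : ProPCompletion p Γ}
    (hf : f.1 N = 1) : f ∈ C := by
  by_contra hfC
  obtain ⟨U, hU, hUC⟩ := isOpen_induced_iff.1 hC.isOpen_compl
  have hfU : f.1 ∈ U := by
    change f ∈ Subtype.val ⁻¹' U
    rw [hUC]
    exact hfC
  obtain ⟨I, u, hu, hIU⟩ := isOpen_pi_iff.1 hU f.1 hfU
  -- A basic neighbourhood of `f` restricts only finitely many coordinates. An `x` agreeing with `f`
  -- modulo a `K` below all of these and below `N` lies in `N`, while its image avoids `C`.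
  obtain ⟨K', hK'⟩ := PPowerNormal.exists_le_of_finite I id
  obtain ⟨K, hK⟩ := PPowerNormal.exists_inf N K'
  obtain ⟨x, hx⟩ := exists_mk'_eq f K
  have hxN : x ∈ N.1 := by
    have := apply_eq_mk'_of_le f (hK ▸ inf_le_left : K.1 ≤ N.1) hx.symm
    rw [hf] at this
    exact (QuotientGroup.eq_one_iff x).1 this.symm
  have hxU : ofHom p Γ x ∈ (C : Set (ProPCompletion p Γ))ᶜ := by
    rw [← hUC]
    refine hIU fun M hM ↦ ?_
    have := apply_eq_mk'_of_le f
      ((hK ▸ inf_le_right : K.1 ≤ K'.1).trans (hK' M hM) : K.1 ≤ M.1) hx.symm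
    change M.mk' x ∈ u M
    rw [← this]
    exact (hu M hM).2
  exact hxU (hN hxN)

/-- The terms of the descending `p`-central series of the pro-`p` completion of a finitely
generated group are open. -/
lemma exists_forall_apply_eq_one_mem_descPCentral [Group.FG Γ] (k : ℕ) :
    ∃ N : PPowerNormal p Γ, ∀ f : ProPCompletion p Γ, f.1 N = 1 →
      f ∈ descPCentral p (ProPCompletion p Γ) k := by
  -- Since the terms are closed, it is enough to control the image of the discrete group, where `N`
  -- can be replaced by `N ^ p [N, N]` at each step.
  suffices ∀ k, ∃ N : PPowerNormal p Γ,
      N.1 ≤ (descPCentral p (ProPCompletion p Γ) (k + 1)).comap (ofHom p Γ) by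
    rcases k with _ | k
    · exact ⟨⟨⊤, inferInstance, 0, by simp⟩, fun _ _ ↦ trivial⟩
    · obtain ⟨N, hN⟩ := this k
      exact ⟨N, fun f hf ↦ mem_of_apply_eq_one (isClosed_descPCentral _ _) hN hf⟩
  intro k
  induction k with
  | zero => exact ⟨⟨⊤, inferInstance, 0, by simp⟩, fun _ _ ↦ trivial⟩
  | succ k ih =>
    obtain ⟨N, hN⟩ := ih
    obtain ⟨K, hK⟩ := N.exists_le_normalClosure_sup_commutator
    refine ⟨K, ?_⟩
    rw [hK]
    refine sup_le (Subgroup.normalClosure_le_normal ?_) (Subgroup.commutator_le.2 ?_)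
    · rintro _ ⟨x, hx, rfl⟩
      change ofHom p Γ (x ^ p) ∈ descPCentral p (ProPCompletion p Γ) (k + 1 + 1)
      rw [map_pow]
      exact pow_mem_descPCentral_succ p (by omega) (hN hx)
    · intro x hx y _
      rw [Subgroup.mem_comap, map_commutatorElement]
      exact commutator_mem_descPCentral_succ p (by omega) (hN hx) _

lemma exists_forall_apply_eq_one_mem_refinedSeries [Group.FG Γ] (ν : FiltIndex) :
    ∃ N : PPowerNormal p Γ, ∀ f : ProPCompletion p Γ, f.1 N = 1 →
      f ∈ refinedSeries p (ProPCompletion p Γ) ν := by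
  obtain ⟨N, hN⟩ := exists_forall_apply_eq_one_mem_descPCentral (p := p) (Γ := Γ) (ν.i + 1)
  exact ⟨N, fun f hf ↦ Subgroup.mem_sup_right (hN f hf)⟩

/-- The projection to `P^{(ν)} / P^{(ν+1)}` depends only on a finite quotient. -/
lemma exists_mk_gradedPiece_eq [Group.FG Γ] (ν : FiltIndex) :
    ∃ (N : PPowerNormal p Γ) (φ : N.Quot → Additive (GradedPiece p (ProPCompletion p Γ) ν)),
      ∀ y : refinedSeries p (ProPCompletion p Γ) ν,
        φ (y.1.1 N) = Additive.ofMul (QuotientGroup.mk y : GradedPiece p _ ν) := by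
  obtain ⟨N, hN⟩ := exists_forall_apply_eq_one_mem_refinedSeries (p := p) (Γ := Γ) ν.next
  let φ (y : refinedSeries p (ProPCompletion p Γ) ν) :
      Additive (GradedPiece p (ProPCompletion p Γ) ν) :=
    Additive.ofMul (QuotientGroup.mk y : GradedPiece p _ ν)
  have hφ : φ.FactorsThrough (fun y ↦ y.1.1 N) := fun y z h ↦ by
    refine congrArg Additive.ofMul (QuotientGroup.eq.2 (hN _ ?_))
    change (y.1.1 N)⁻¹ * z.1.1 N = 1
    rw [inv_mul_eq_one]
    exact h
  -- The value `0` off the image of `P^{(ν)}` is arbitrary.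
  exact ⟨N, Function.extend (fun y ↦ y.1.1 N) φ 0, fun y ↦ hφ.extend_apply 0 y⟩

instance finite_gradedPiece [Group.FG Γ] (ν : FiltIndex) :
    Finite (Additive (GradedPiece p (ProPCompletion p Γ) ν)) := by
  obtain ⟨N, φ, hφ⟩ := exists_mk_gradedPiece_eq (p := p) (Γ := Γ) ν
  refine Finite.of_surjective φ fun a ↦ ?_
  obtain ⟨y, hy⟩ := QuotientGroup.mk_surjective (Additive.toMul a)
  exact ⟨_, (hφ y).trans (congrArg Additive.ofMul hy)⟩

/-- Finitely many homomorphisms into `p`-groups cannot distinguish an element of the completion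
from a suitable element of the discrete group. -/
lemma exists_forall_map_apply_eq {Γ' κ : Type} [Group Γ'] [Finite κ] (ψ : κ → Γ →* Γ')
    (N : PPowerNormal p Γ') (f : ProPCompletion p Γ) :
    ∃ w : Γ, ∀ i, (map (ψ i) f).1 N = N.mk' (ψ i w) := by
  have := Fintype.ofFinite κ
  obtain ⟨K, hK⟩ := PPowerNormal.exists_le_of_finite Finset.univ fun i ↦ N.comap (ψ i)
  obtain ⟨w, hw⟩ := exists_mk'_eq f K
  refine ⟨w, fun i ↦ ?_⟩
  change N.quotMap (ψ i) (f.1 (N.comap (ψ i))) = _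
  rw [apply_eq_mk'_of_le f (hK i (Finset.mem_univ i)) hw.symm]
  rfl

end ProPCompletion

/-! ### Finiteness of Tate cohomology, and polynomial families under additive functors -/

section TateCohomology

lemma HomologicalComplex.finite_homology {k ι : Type*} [CommRing k] [IsNoetherianRing k]
    {c : ComplexShape ι} (K : HomologicalComplex (ModuleCat k) c) (i : ι)
    [Module.Finite k (K.X i)] : Module.Finite k (K.homology i) := by
  have : Module.Finite k (K.cycles i) :=
    Module.Finite.of_injective (K.iCycles i).hom ((ModuleCat.mono_iff_injective _).1 inferInstance)
  exact Module.Finite.of_surjective (K.homologyπ i).hom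
    ((ModuleCat.epi_iff_surjective _).1 inferInstance)

instance finite_tateCohomology {k G : Type} [CommRing k] [IsNoetherianRing k] [Group G] [Fintype G]
    (M : Rep k G) [Module.Finite k M] (i : ℤ) : Module.Finite k (tateCohomology M i) := by
  have : Module.Finite k ((tateComplex M).X i) := by
    rcases i with n | n
    · exact inferInstanceAs (Module.Finite k ((Fin n → G) → M))
    · exact inferInstanceAs (Module.Finite k ((Fin n → G) →₀ M))
  exact (tateComplex M).finite_homology i

instance additive_tateCohomologyFunctor {k G : Type} [CommRing k] [Group G] [Fintype G] (i : ℤ) :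
    (tateCohomologyFunctor (R := k) (G := G) i).Additive :=
  inferInstanceAs (tateComplexFunctor k G ⋙ HomologicalComplex.homologyFunctor _ _ i).Additive

open Finset in
/-- An additive functor does not increase the degree of a family of morphisms. -/
lemma Rep.hasBoolDegreeLE_map {ι k G : Type} [CommRing k] [Group G] [DecidableEq ι]
    {M N : Rep k G} {d : ℕ} {f : Finset ι → (M ⟶ N)}
    (hf : ∀ x : M, HasBoolDegreeLE d fun S ↦ (f S).hom x) (F : Rep k G ⥤ ModuleCat k)
    [F.Additive] (x : F.obj M) : HasBoolDegreeLE d fun S ↦ F.map (f S) x := by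
  -- Inverting in the group of morphisms gives coefficients to which `F` applies; uniqueness of
  -- coefficients at each `y` shows that those of high degree vanish.
  obtain ⟨h, hh⟩ := HasBoolDegreeLE.exists_eq_sum_powerset f
  have h0 (U : Finset ι) (hU : d < #U) : h U = 0 := by
    ext y
    obtain ⟨a, ha, hay⟩ := hf y
    have : (h U).hom y = a U := by
      refine HasBoolDegreeLE.eq_of_sum_powerset_eq (a := fun U ↦ (h U).hom y) (fun S ↦ (?_ : _ = (f S).hom y).trans (hay S)) U
      rw [hh, Rep.sum_hom, Representation.IntertwiningMap.sum_apply]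
    simpa [ha U hU] using this
  refine ⟨fun U ↦ F.map (h U) x, fun U hU ↦ ?_, fun S ↦ ?_⟩
  · simp [h0 U hU]
  · simp [hh S, F.map_sum]

end TateCohomology

/-! ### The switching homomorphisms -/

namespace FreeProPOperatorGroup

variable {G : Type} {m n r : ℕ}

/-- Letters carry a position `c a = (i, b)`; the letters `x_{a,g}` with `i ∈ S` are mapped to
`x_{b,g}`, the others to `1`. -/
noncomputable def switch (G : Type) (c : Fin m → Option (Fin r × Fin n)) (S : Finset (Fin r)) :
    FreeGroup (Fin m × G) →* FreeGroup (Fin n × G) :=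
  FreeGroup.lift fun x ↦ (c x.1).elim 1 fun y ↦ if y.1 ∈ S then .of (y.2, x.2) else 1

lemma switch_comp_translate [Group G] (c : Fin m → Option (Fin r × Fin n)) (S : Finset (Fin r)) (g : G) :
    (switch G c S).comp (freeGroupTranslate m g) =
      (freeGroupTranslate n g).comp (switch G c S) := by
  ext x
  simp only [switch, freeGroupTranslate, MonoidHom.comp_apply, FreeGroup.map.of,
    FreeGroup.lift_apply_of]
  cases c x.1 with
  | none => simp
  | some y => by_cases h : y.1 ∈ S <;> simp [h]

lemma switch_empty (c : Fin m → Option (Fin r × Fin n)) (w : FreeGroup (Fin m × G)) :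
    switch G c ∅ w = 1 := by
  have : switch G c ∅ = 1 := by
    ext x
    simp only [switch, FreeGroup.lift_apply_of]
    cases c x.1 <;> simp
  rw [this, MonoidHom.one_apply]

/-- A single block `i ∈ S` already contains a copy of the basis, which gives a section. -/
lemma exists_switch_comp_eq_id {c : Fin m → Option (Fin r × Fin n)} {S : Finset (Fin r)}
    (hc : ∀ y, ∃ a, c a = some y) (hS : S.Nonempty) :
    ∃ σ : FreeGroup (Fin n × G) →* FreeGroup (Fin m × G), (switch G c S).comp σ = .id _ := by
  obtain ⟨i, hi⟩ := hS
  choose a ha using fun b ↦ hc (i, b)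
  refine ⟨FreeGroup.map fun x ↦ (a x.1, x.2), ?_⟩
  ext x
  simp [switch, ha, hi]

variable {p : ℕ} [Fact p.Prime]

lemma map_switch_surjective {c : Fin m → Option (Fin r × Fin n)} {S : Finset (Fin r)}
    (hc : ∀ y, ∃ a, c a = some y) (hS : S.Nonempty) :
    Function.Surjective (ProPCompletion.map (p := p) (switch G c S)) := fun y ↦ by
  obtain ⟨σ, hσ⟩ := exists_switch_comp_eq_id (G := G) hc hS
  exact ⟨ProPCompletion.map σ y, by
    rw [← ProPCompletion.map_comp_apply, hσ, ProPCompletion.map_id_apply]⟩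

lemma map_switch_smul [Group G] (c : Fin m → Option (Fin r × Fin n)) (S : Finset (Fin r)) (g : G)
    (y : FreeProPOperatorGroup p G m) :
    ProPCompletion.map (switch G c S) (g • y) =
      (g • ProPCompletion.map (switch G c S) y : FreeProPOperatorGroup p G n) := by
  change ProPCompletion.map _ (ProPCompletion.map _ y) =
    ProPCompletion.map _ (ProPCompletion.map _ y)
  rw [← ProPCompletion.map_comp_apply, ← ProPCompletion.map_comp_apply, switch_comp_translate]

/-- The map on `F(m)^{(ν)} / F(m)^{(ν+1)}` induced by `switch`. -/
noncomputable def gradedSwitch (p : ℕ) [Fact p.Prime] (G : Type) [Group G]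
    (c : Fin m → Option (Fin r × Fin n)) (ν : FiltIndex) (S : Finset (Fin r)) :
    gradedRep p (FreeProPOperatorGroup p G m) G ν ⟶ gradedRep p (FreeProPOperatorGroup p G n) G ν :=
  gradedRepMap p (ProPCompletion.map (switch G c S)) (map_switch_smul c S) ν

lemma gradedSwitch_empty [Group G] (c : Fin m → Option (Fin r × Fin n)) (ν : FiltIndex) :
    gradedSwitch p G c ν ∅ = 0 := by
  have h1 (y : FreeProPOperatorGroup p G m) :
      (ProPCompletion.map (switch G c ∅) y : FreeProPOperatorGroup p G n) = 1 := by
    refine Subtype.ext (funext fun N ↦ ?_)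
    obtain ⟨w, hw⟩ := ProPCompletion.exists_forall_map_apply_eq (fun _ : Unit ↦ switch G c ∅) N y
    rw [hw (), switch_empty, map_one]
    rfl
  ext x
  obtain ⟨y, hy⟩ := QuotientGroup.mk_surjective (Additive.toMul x)
  obtain rfl : x = Additive.ofMul (QuotientGroup.mk y : GradedPiece p _ ν) := hy.symm
  exact congrArg QuotientGroup.mk (Subtype.ext (h1 y.1))

/-- The degree of the dependence of `gradedSwitch` on `S` is bounded in terms of the target. -/
lemma exists_hasBoolDegreeLE_gradedSwitch (p : ℕ) [Fact p.Prime] (G : Type) [Group G] [Finite G]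
    (n : ℕ) (ν : FiltIndex) :
    ∃ d : ℕ, ∀ (m r : ℕ) [NeZero r] (c : Fin m → Option (Fin r × Fin n))
      (x : gradedRep p (FreeProPOperatorGroup p G m) G ν),
      HasBoolDegreeLE d fun S ↦ (gradedSwitch p G c ν S).hom x := by
  obtain ⟨N, φ, hφ⟩ :=
    ProPCompletion.exists_mk_gradedPiece_eq (p := p) (Γ := FreeGroup (Fin n × G)) ν
  obtain ⟨d, hd⟩ := N.isPGroup_quot.exists_hasBoolDegreeLE
  refine ⟨d, fun m r _ c x ↦ ?_⟩
  obtain ⟨y, hy⟩ := QuotientGroup.mk_surjective (Additive.toMul x)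
  -- One discrete word `w` serves all `S` at once, so the bound for words applies.
  obtain ⟨w, hw⟩ := ProPCompletion.exists_forall_map_apply_eq (switch G c) N y.1
  -- Letters without a position get the dummy variable `0`; this is harmless, as their value is `1`
  -- in either state.
  have key := hd (fun S ↦ N.mk'.comp (switch G c S)) (fun x ↦ ((c x.1).map Prod.fst).getD 0)
    (fun x ↦ (c x.1).elim 1 fun y ↦ N.mk' (.of (y.2, x.2))) (fun x S ↦ by
      simp only [switch, MonoidHom.comp_apply, FreeGroup.lift_apply_of]
      cases c x.1 with
      | none => simp
      | some y => by_cases h : y.1 ∈ S <;> simp [h]) φ w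
  obtain rfl : x = Additive.ofMul (QuotientGroup.mk y : GradedPiece p _ ν) := hy.symm
  have h (S : Finset (Fin r)) : (gradedSwitch p G c ν S).hom
      (Additive.ofMul (QuotientGroup.mk y : GradedPiece p _ ν)) = φ (N.mk' (switch G c S w)) := by
    rw [← hw]
    exact (hφ ⟨ProPCompletion.map (switch G c S) y.1, refinedSeries_le_comap p _ ν y.2⟩).symm
  obtain ⟨a, ha, h'⟩ := key
  exact ⟨a, ha, fun S ↦ (h S).trans (h' S)⟩

end FreeProPOperatorGroup

/-! ### The main theorem -/

open FreeProPOperatorGroup in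
theorem proposition6 (p : ℕ) [Fact p.Prime] (G : Type) [Group G] [Fintype G]
    (n t : ℕ) (k : ℤ) (T : Rep (ZMod p) G) [Module.Finite (ZMod p) T] (ν : FiltIndex) :
    ∃ m₀ : ℕ, n ≤ m₀ ∧ ∀ m : ℕ, m₀ ≤ m →
      ∀ x : Fin t → tateCohomology (gradedRep p (FreeProPOperatorGroup p G m) G ν ⊗ T) k,
        ∃ (ψ : FreeProPOperatorGroup p G m →ₜ* FreeProPOperatorGroup p G n)
          (hψ : ∀ (g : G) (y : FreeProPOperatorGroup p G m), ψ (g • y) = g • ψ y),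
          Function.Surjective ψ ∧
            ∀ a : Fin t,
              (tateCohomologyFunctor k).map (gradedRepMap p ψ hψ ν ▷ T) (x a) = 0 := by
  obtain ⟨d, hd⟩ := exists_hasBoolDegreeLE_gradedSwitch p G n ν
  have : Module.Finite (ZMod p) (gradedRep p (FreeProPOperatorGroup p G n) G ν) :=
    have := ProPCompletion.finite_gradedPiece (p := p) (Γ := FreeGroup (Fin n × G)) ν
    Module.Finite.of_finite (R := ZMod p)
      (M := Additive (GradedPiece p (FreeProPOperatorGroup p G n) ν))
  have : Module.Finite (ZMod p) ↑(gradedRep p (FreeProPOperatorGroup p G n) G ν ⊗ T) :=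
    inferInstanceAs (Module.Finite (ZMod p) (TensorProduct (ZMod p) _ _))
  let H := tateCohomology (gradedRep p (FreeProPOperatorGroup p G n) G ν ⊗ T) k
  -- One more than the Chevalley–Warning bound for `t` equations in `H`; also `r > 0`, so that `n ≤
  -- r * n`.
  let r := d * (p - 1) * (t * Module.finrank (ZMod p) H) + 1
  refine ⟨r * n, Nat.le_mul_of_pos_left n (Nat.succ_pos _), fun m hm x ↦ ?_⟩
  -- The letters beyond the first `r * n` have no position and are always killed, so every `m ≥ r *
  -- n` works.
  let c (a : Fin m) : Option (Fin r × Fin n) :=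
    if h : a < r * n then some (finProdFinEquiv.symm ⟨a, h⟩) else none
  have hc (y : Fin r × Fin n) : ∃ a, c a = some y :=
    ⟨(finProdFinEquiv y).castLE hm, (dif_pos (finProdFinEquiv y).2).trans
      (congrArg some (finProdFinEquiv.symm_apply_apply y))⟩
  let F : Rep (ZMod p) G ⥤ ModuleCat (ZMod p) := tensorRight T ⋙ tateCohomologyFunctor k
  obtain ⟨S, hS, h⟩ := HasBoolDegreeLE.exists_nonempty_forall_eq_zero_of_finite (p := p) (V := H)
    (fun a : Fin t ↦ Rep.hasBoolDegreeLE_map (hd m r c) F (x a)) (fun a ↦ by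
      simp [gradedSwitch_empty]) (by simp [r, H])
  exact ⟨ProPCompletion.map (switch G c S), map_switch_smul c S, map_switch_surjective hc hS, h⟩
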